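/- **Theorem 4.1.** *The AKNS quantities.* Let $q,r$ be differential indeterminates with total derivative $\partial=\partial_x$. Define differential polynomials $a_i,b_i,c_i$ ($i\ge 0$) in $q,r$ and their $x$-derivatives by $a_0=-1$, $b_0=c_0=0$ and $$a_{i+1}=\tfrac12\,\partial^{-1}\bigl(q\,\partial c_i+r\,\partial b_i\bigr),\qquad b_{i+1}=-\tfrac12\,\partial b_i-q\,a_i,\qquad c_{i+1}=\tfrac12\,\partial c_i-r\,a_i ,$$ where $\partial^{-1}p$ is the differential polynomial $g$ with $\partial g=p$ and zero constant term, i.e. $g|_{q=r=0}=0$. *The nonlinearized spatial system.* Let $N\ge 0$ be an integer and let $\lambda_1,\dots,\lambda_N$ and $\mu_1,\dots,\mu_N$ be real numbers; put $A=\mathrm{diag}(\lambda_1,\dots,\lambda_N)$, $B=\mathrm{diag}(\mu_1,\dots,\mu_N)$, and let $\langle\cdot,\cdot\rangle$ be the standard inner product of $\mathbb R^N$. For $P_i=(\phi_{i1},\dots,\phi_{iN})^T$ and $Q_i=(\psi_{i1},\dots,\psi_{iN})^T$ in $\mathbb R^N$ ($i=1,2,3$) put $$\widetilde q=\sqrt2\,(\langle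 P_1,BQ_2\rangle+\langle P_2,BQ_3\rangle),\qquad \widetilde r=\sqrt2\,(\langle P_2,BQ_1\rangle+\langle P_3,BQ_2\rangle),$$ $$U_j=\begin{pmatrix}-2\lambda_j&\sqrt2\,\widetilde q&0\\ \sqrt2\,\widetilde r&0&\sqrt2\,\widetilde q\\ 0&\sqrt2\,\widetilde r&2\lambda_j\end{pmatrix}.$$ Let $J\subseteq\mathbb R$ be open and let the real functions $\phi_{ij},\psi_{ij}$ of $x$ satisfy on $J$, for $1\le j\le N$, $$(\phi_{1j},\phi_{2j},\phi_{3j})^T_x=U_j(\phi_{1j},\phi_{2j},\phi_{3j})^T,\qquad (\psi_{1j},\psi_{2j},\psi_{3j})^T_x=-U_j^T(\psi_{1j},\psi_{2j},\psi_{3j})^T .$$ Let $\widetilde a_m,\widetilde b_m,\widetilde c_m$ be the functions on $J$ obtained from $a_m,b_m,c_m$ by substituting the functions $\widetilde q,\widetilde r$ and their $x$-derivatives for $q,r$ and their derivatives. *The functions $F_m$, $I_m$.* Put $F_1=-8(\langle P_1,BQ_1\rangle-\langle P_3,BQ_3\rangle)$ and, for $m\ge2$, $$\begin{aligned}F_m={}&4\sum_{i=1}^{m-1}\Bigl[(\langle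 A^{i-1}P_1,BQ_1\rangle-\langle A^{i-1}P_3,BQ_3\rangle)(\langle A^{m-i-1}P_1,BQ_1\rangle-\langle A^{m-i-1}P_3,BQ_3\rangle)\\&\quad+2(\langle A^{i-1}P_1,BQ_2\rangle+\langle A^{i-1}P_2,BQ_3\rangle)(\langle A^{m-i-1}P_2,BQ_1\rangle+\langle A^{m-i-1}P_3,BQ_2\rangle)\Bigr]\\&-8(\langle A^{m-1}P_1,BQ_1\rangle-\langle A^{m-1}P_3,BQ_3\rangle).\end{aligned}$$ Define constants $d_n$ ($n\ge1$) by $d_1=-\frac18$, $d_2=\frac3{128}$ and $$d_n=-\frac12\sum_{i=1}^{n-1}d_id_{n-i}-\frac14d_{n-1}-\frac18\sum_{i=1}^{n-2}d_id_{n-i-1}\qquad(n\ge3),$$ and put $$I_0=1,\qquad I_m=\sum_{n=1}^m d_n\sum_{\substack{i_1+\cdots+i_n=m\\ i_1,\dots,i_n\ge1}}F_{i_1}\cdots F_{i_n}\qquad(m\ge1).$$ *Conclusion.* For every $m\ge0$, at every point of $J$, $$\widetilde a_{m+1}=\sum_{i=0}^mI_i\bigl(\langle A^{m-i}P_1,BQ_1\rangle-\langle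 A^{m-i}P_3,BQ_3\rangle\bigr)-I_{m+1},$$ $$\widetilde b_{m+1}=\sqrt2\sum_{i=0}^mI_i\bigl(\langle A^{m-i}P_1,BQ_2\rangle+\langle A^{m-i}P_2,BQ_3\rangle\bigr),$$ $$\widetilde c_{m+1}=\sqrt2\sum_{i=0}^mI_i\bigl(\langle A^{m-i}P_2,BQ_1\rangle+\langle A^{m-i}P_3,BQ_2\rangle\bigr).$$ -/

import Mathlib

open scoped Matrix

namespace AKNS

noncomputable section

/-! ### Differential polynomials and the AKNS recursion -/

/-- Differential polynomials in the potential `u = (q, r)`: the variable `(0, k)` is the `k`-th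
`x`-derivative of `q` and the variable `(1, k)` is the `k`-th `x`-derivative of `r`. -/
abbrev DiffPoly : Type := MvPolynomial (Fin 2 × ℕ) ℝ

/-- The potential `q` as a differential polynomial. -/
def qVar : DiffPoly := MvPolynomial.X (0, 0)

/-- The potential `r` as a differential polynomial. -/
def rVar : DiffPoly := MvPolynomial.X (1, 0)

/-- The total `x`-derivative: the derivation with `∂ u^(k) = u^(k+1)`. -/
def totalDeriv : Derivation ℝ DiffPoly DiffPoly :=
  MvPolynomial.mkDerivation ℝ fun v => MvPolynomial.X (v.1, v.2 + 1)

open Classical in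
/-- `∂⁻¹ p`: the differential polynomial `g` with `∂ g = p` and `g|_{u = 0} = 0`, that is, with the
constant of integration equal to zero (and `0` if `p` is not a total derivative). -/
def invDeriv (p : DiffPoly) : DiffPoly :=
  if h : ∃ g : DiffPoly, totalDeriv g = p ∧ MvPolynomial.constantCoeff g = 0
  then h.choose else 0

/-- The triples `(a_i, b_i, c_i)` of differential polynomials: `a_0 = -1`, `b_0 = c_0 = 0` and
`a_{i+1} = ½ ∂⁻¹ (q ∂c_i + r ∂b_i)`, `b_{i+1} = -½ ∂b_i - q a_i`, `c_{i+1} = ½ ∂c_i - r a_i`. -/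
def abc : ℕ → DiffPoly × DiffPoly × DiffPoly
  | 0 => (-1, 0, 0)
  | i + 1 =>
    ((1 / 2 : ℝ) • invDeriv (qVar * totalDeriv (abc i).2.2 + rVar * totalDeriv (abc i).2.1),
      -((1 / 2 : ℝ) • totalDeriv (abc i).2.1) - qVar * (abc i).1,
      (1 / 2 : ℝ) • totalDeriv (abc i).2.2 - rVar * (abc i).1)

/-- The quantity `a_i`. -/
def a (i : ℕ) : DiffPoly := (abc i).1

/-- The quantity `b_i`. -/
def b (i : ℕ) : DiffPoly := (abc i).2.1

/-- The quantity `c_i`. -/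
def c (i : ℕ) : DiffPoly := (abc i).2.2

/-- The value at `x` of a differential polynomial at the potential `u = (q, r)`, `q r : ℝ → ℝ`. -/
def evalAt (q r : ℝ → ℝ) (p : DiffPoly) (x : ℝ) : ℝ :=
  MvPolynomial.eval (fun v => iteratedDeriv v.2 (![q, r] v.1) x) p

/-! ### The nonlinearized spatial system

The points of the phase space are pairs `P Q : Fin 3 → Fin N → ℝ`; the entries `P i j`, `Q i j` are
`φ_{ij}`, `ψ_{ij}`, the first index being counted from `0`. -/

/-- The spectral matrix `U(u, λ)` with `u = (q, r)`. -/
def U (q r lam : ℝ) : Matrix (Fin 3) (Fin 3) ℝ :=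
  !![-2 * lam, √2 * q, 0;
     √2 * r, 0, √2 * q;
     0, √2 * r, 2 * lam]

variable {N : ℕ}

/-- `⟨A^k v, B w⟩` with `A = diag(λ_1, …, λ_N)`, `B = diag(μ_1, …, μ_N)` and the standard inner
product of `ℝ^N`. -/
def pair (lam mu : Fin N → ℝ) (k : ℕ) (v w : Fin N → ℝ) : ℝ :=
  ((Matrix.diagonal lam ^ k) *ᵥ v) ⬝ᵥ (Matrix.diagonal mu *ᵥ w)

/-- `⟨A^k P_1, B Q_1⟩ - ⟨A^k P_3, B Q_3⟩`. -/
def pairA (lam mu : Fin N → ℝ) (k : ℕ) (P Q : Fin 3 → Fin N → ℝ) : ℝ :=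
  pair lam mu k (P 0) (Q 0) - pair lam mu k (P 2) (Q 2)

/-- `⟨A^k P_1, B Q_2⟩ + ⟨A^k P_2, B Q_3⟩`. -/
def pairB (lam mu : Fin N → ℝ) (k : ℕ) (P Q : Fin 3 → Fin N → ℝ) : ℝ :=
  pair lam mu k (P 0) (Q 1) + pair lam mu k (P 1) (Q 2)

/-- `⟨A^k P_2, B Q_1⟩ + ⟨A^k P_3, B Q_2⟩`. -/
def pairC (lam mu : Fin N → ℝ) (k : ℕ) (P Q : Fin 3 → Fin N → ℝ) : ℝ :=
  pair lam mu k (P 1) (Q 0) + pair lam mu k (P 2) (Q 1)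

/-- First component of the potential `u = f(P, Q)`: `q = √2 (⟨P_1, B Q_2⟩ + ⟨P_2, B Q_3⟩)`. -/
def qPot (lam mu : Fin N → ℝ) (P Q : Fin 3 → Fin N → ℝ) : ℝ := √2 * pairB lam mu 0 P Q

/-- Second component of the potential `u = f(P, Q)`: `r = √2 (⟨P_2, B Q_1⟩ + ⟨P_3, B Q_2⟩)`. -/
def rPot (lam mu : Fin N → ℝ) (P Q : Fin 3 → Fin N → ℝ) : ℝ := √2 * pairC lam mu 0 P Q

/-- `(P, Q)` solves the nonlinearized spatial system on `J`: at every `x ∈ J` and for every `j`,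
`φ^(j)_x = U(f, λ_j) φ^(j)` and `ψ^(j)_x = -U(f, λ_j)ᵀ ψ^(j)`. -/
def IsSpatialSolution (lam mu : Fin N → ℝ) (J : Set ℝ) (P Q : ℝ → Fin 3 → Fin N → ℝ) : Prop :=
  ∀ x ∈ J, ∀ j : Fin N,
    HasDerivAt (fun y => fun i => P y i j)
      (U (qPot lam mu (P x) (Q x)) (rPot lam mu (P x) (Q x)) (lam j) *ᵥ fun i => P x i j) x ∧
    HasDerivAt (fun y => fun i => Q y i j)
      (-(U (qPot lam mu (P x) (Q x)) (rPot lam mu (P x) (Q x)) (lam j))ᵀ *ᵥ fun i => Q x i j) x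

/-- `Z̃`: the value at `x` of the differential polynomial `Z` after the substitution
`u = f(P, Q)`. -/
def tilde (lam mu : Fin N → ℝ) (P Q : ℝ → Fin 3 → Fin N → ℝ) (Z : DiffPoly) (x : ℝ) : ℝ :=
  evalAt (fun y => qPot lam mu (P y) (Q y)) (fun y => rPot lam mu (P y) (Q y)) Z x

/-! ### The functions `F_m`, the constants `d_n` and the functions `I_m` -/

/-- The functions `F_m` on the phase space (with `F_0 = 4`, which is not used below). -/
def F (lam mu : Fin N → ℝ) (P Q : Fin 3 → Fin N → ℝ) : ℕ → ℝ
  | 0 => 4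
  | 1 => -8 * pairA lam mu 0 P Q
  | m + 2 =>
    4 * ∑ i ∈ Finset.Icc 1 (m + 1),
        (pairA lam mu (i - 1) P Q * pairA lam mu (m + 2 - i - 1) P Q
          + 2 * pairB lam mu (i - 1) P Q * pairC lam mu (m + 2 - i - 1) P Q)
      - 8 * pairA lam mu (m + 1) P Q

/-- The constants `d_n` (with `d_0 = 1`, which is not used below); the recursion in its usual form
is `d_rec`. -/
def d : ℕ → ℝ
  | 0 => 1
  | 1 => -1 / 8
  | 2 => 3 / 128
  | n + 3 =>
    -(1 / 2) * ∑ i : Fin (n + 2), d (i + 1) * d (n + 2 - i) - 1 / 4 * d (n + 2)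
      - 1 / 8 * ∑ i : Fin (n + 1), d (i + 1) * d (n + 1 - i)
  decreasing_by all_goals omega

theorem d_rec (n : ℕ) (hn : 3 ≤ n) :
    d n = -(1 / 2) * ∑ i ∈ Finset.Icc 1 (n - 1), d i * d (n - i) - 1 / 4 * d (n - 1)
      - 1 / 8 * ∑ i ∈ Finset.Icc 1 (n - 2), d i * d (n - i - 1) := by
  obtain ⟨k, rfl⟩ := Nat.exists_eq_add_of_le' hn
  have key : ∀ (l : ℕ) (g : ℕ → ℝ),
      ∑ i ∈ Finset.Icc 1 l, g i = ∑ i : Fin l, g (i + 1) := by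
    intro l g
    rw [Fin.sum_univ_eq_sum_range (fun i => g (i + 1)) l, Finset.range_eq_Ico,
      Finset.sum_Ico_add' g 0 l 1]
    rfl
  rw [d, key, key]
  have h1 : ∀ i : ℕ, k + 3 - (i + 1) = k + 2 - i := fun i => by omega
  have h2 : ∀ i : ℕ, k + 2 - i - 1 = k + 1 - i := fun i => by omega
  simp only [h1, h2]
  rfl

/-- `I_0 = 1` and, for `m ≥ 1`, `I_m = ∑_{n=1}^m d_n ∑ F_{i_1} ⋯ F_{i_n}`, where the inner sum
runs over all `n`-tuples of integers `i_1, …, i_n ≥ 1` with `i_1 + ⋯ + i_n = m`. -/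
def I (lam mu : Fin N → ℝ) (P Q : Fin 3 → Fin N → ℝ) : ℕ → ℝ
  | 0 => 1
  | m + 1 =>
    ∑ n ∈ Finset.Icc 1 (m + 1), d n *
      ∑ t ∈ (Finset.Nat.antidiagonalTuple n (m + 1)).filter (fun t => ∀ k, 1 ≤ t k),
        ∏ k, F lam mu P Q (t k)

end

end AKNS

/-!
Write `α = ∑ a_i t^i`, `β = ∑ b_i t^i`, `γ = ∑ c_i t^i` with `t = λ⁻¹`. The recursion says that
`α_x = qγ - rβ`, `tβ_x = -2β - 2tqα`, `tγ_x = 2γ + 2trα`, and together with the normalization of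
`∂⁻¹` it gives `α² + βγ = 1` (`quad_succ`). For the latter one needs that the arguments of `∂⁻¹`
are total derivatives (`totalDeriv_a_and_constantCoeff_a`) and that the kernel of `∂` consists of
the constants (`eq_zero_of_totalDeriv_eq_zero`).

Along a solution of the nonlinearized spatial system, the series
`α̂ = -1 + ∑ (⟨A^k P_1, B Q_1⟩ - ⟨A^k P_3, B Q_3⟩) t^(k+1)` and its companions `β̂`, `γ̂` satisfy the
same three equations; at order zero the equation for `β̂` and `γ̂` is the definition of the potential
`(q, r)` by `(P, Q)`. Hence `α̂² + β̂γ̂` is a first integral. Its coefficients are `F_m / 4`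
(`F_eq`), and the recursion of `d_n` says that `∑ d_n y^n = (1 + y / 4)^(-1/2)`, so that
`∑ I_m t^m = (α̂² + β̂γ̂)^(-1/2)` (`mk_I_sq_mul`). Multiplication by this constant series produces
a solution of the same equations with the normalization `α² + βγ = 1`. These determine all
coefficients from `a_0 = -1`, `b_0 = c_0 = 0`, since `b_{m+1}` and `c_{m+1}` come from the
preceding order and `a_{m+1}` from the normalization (`IsSpatialSolution.tilde_eq_convI`).
-/

namespace AKNS

noncomputable section

/-! ### The kernel of the total derivative -/

@[simp]
theorem totalDeriv_X (v : Fin 2 × ℕ) :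
    totalDeriv (MvPolynomial.X v) = MvPolynomial.X (v.1, v.2 + 1) :=
  MvPolynomial.mkDerivation_X _ _ _

theorem constantCoeff_totalDeriv (p : DiffPoly) :
    MvPolynomial.constantCoeff (totalDeriv p) = 0 := by
  induction p using MvPolynomial.induction_on with
  | C r => simp
  | add p q hp hq => simp [hp, hq]
  | mul_X p v hp => simp [Derivation.leibniz]

/-- The commutation relation `[∂/∂u^(k+1), ∂] = ∂/∂u^(k)`. -/
theorem pderiv_succ_totalDeriv (i : Fin 2) (k : ℕ) (p : DiffPoly) :
    MvPolynomial.pderiv (i, k + 1) (totalDeriv p) =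
      totalDeriv (MvPolynomial.pderiv (i, k + 1) p) + MvPolynomial.pderiv (i, k) p := by
  have h : ⁅MvPolynomial.pderiv (R := ℝ) (i, k + 1), totalDeriv⁆
      = MvPolynomial.pderiv (i, k) := by
    refine MvPolynomial.derivation_ext fun v => ?_
    obtain ⟨j, l⟩ := v
    rw [Derivation.commutator_apply, totalDeriv_X, MvPolynomial.pderiv_X, MvPolynomial.pderiv_X,
      MvPolynomial.pderiv_X]
    have h1 : totalDeriv ((Pi.single (i, k + 1) 1 : Fin 2 × ℕ → DiffPoly) (j, l)) = 0 := by
      by_cases hv : (j, l) = (i, k + 1)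
      · rw [hv, Pi.single_eq_same, Derivation.map_one_eq_zero]
      · rw [Pi.single_eq_of_ne hv, map_zero]
    rw [h1, sub_zero]
    simp [Pi.single_apply]
  rw [← h, Derivation.commutator_apply]
  ring

/-- If `∂ p = 0` and `k` bounds the order of the derivatives in `p`, then
`∂p/∂u^(k) = [∂/∂u^(k+1), ∂] p = 0`; descending in `k`, all partial derivatives vanish. -/
theorem pderiv_eq_zero_of_totalDeriv_eq_zero {p : DiffPoly} (hp : totalDeriv p = 0)
    (v : Fin 2 × ℕ) : MvPolynomial.pderiv v p = 0 := by
  obtain ⟨i, k⟩ := v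
  obtain ⟨M, hM⟩ : ∃ M : ℕ, ∀ w ∈ p.vars, w.2 < M :=
    ⟨p.vars.sup Prod.snd + 1, fun w hw => Nat.lt_succ_of_le (Finset.le_sup (f := Prod.snd) hw)⟩
  have hlarge : ∀ l, M ≤ l → MvPolynomial.pderiv (i, l) p = 0 := fun l hl =>
    MvPolynomial.pderiv_eq_zero_of_notMem_vars fun hmem => absurd (hM _ hmem) (by simpa using hl)
  rcases le_total M k with hk | hk
  · exact hlarge k hk
  · induction hk using Nat.decreasingInduction with
    | self => exact hlarge M le_rfl
    | of_succ l _ ih =>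
      have h := pderiv_succ_totalDeriv i l p
      rwa [hp, ih, map_zero, map_zero, zero_add, eq_comm] at h

theorem eq_zero_of_totalDeriv_eq_zero {p : DiffPoly} (hp : totalDeriv p = 0)
    (h0 : MvPolynomial.constantCoeff p = 0) : p = 0 := by
  ext m
  rw [MvPolynomial.coeff_zero]
  by_cases hm : m = 0
  · rw [hm]
    exact h0
  · obtain ⟨v, hv⟩ := Finsupp.ne_iff.mp hm
    have h := MvPolynomial.coeff_pderiv (i := v) p (m - Finsupp.single v 1)
    have hle : Finsupp.single v 1 ≤ m := by
      rw [Finsupp.single_le_iff]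
      exact Nat.one_le_iff_ne_zero.mpr hv
    rw [pderiv_eq_zero_of_totalDeriv_eq_zero hp, MvPolynomial.coeff_zero,
      tsub_add_cancel_of_le hle, eq_comm, mul_eq_zero] at h
    exact h.resolve_right (by positivity)

theorem totalDeriv_invDeriv {p g : DiffPoly} (hg : totalDeriv g = p)
    (h0 : MvPolynomial.constantCoeff g = 0) :
    totalDeriv (invDeriv p) = p ∧ MvPolynomial.constantCoeff (invDeriv p) = 0 := by
  have h : ∃ g : DiffPoly, totalDeriv g = p ∧ MvPolynomial.constantCoeff g = 0 := ⟨g, hg, h0⟩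
  rw [invDeriv, dif_pos h]
  exact h.choose_spec

/-! ### Convolution identities -/

section Convolution

open Finset

variable {R : Type*} [CommRing R]

theorem sum_antidiagonal_mul_of_eq_zero {x y : ℕ → R} {n : ℕ} (hy : ∀ i < n, y i = 0) :
    ∑ p ∈ HasAntidiagonal.antidiagonal n, x p.1 * y p.2 = x 0 * y n := by
  refine sum_eq_single_of_mem (0, n) (by simp) fun p hp hne => ?_
  rw [HasAntidiagonal.mem_antidiagonal] at hp
  rw [hy p.2, mul_zero]
  refine lt_of_le_of_ne (by omega) fun h => hne ?_
  ext <;> simp only <;> omega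

/-- Only the two extreme terms of `∑ x_i x_{n+1-i}` involve `x_{n+1}`. -/
theorem sum_antidiagonal_mul_self_sub {x y : ℕ → R} {n : ℕ} (h : ∀ i ≤ n, x i = y i) :
    ∑ p ∈ HasAntidiagonal.antidiagonal (n + 1), x p.1 * x p.2
        - ∑ p ∈ HasAntidiagonal.antidiagonal (n + 1), y p.1 * y p.2
      = 2 * x 0 * (x (n + 1) - y (n + 1)) := by
  have e : ∀ p ∈ HasAntidiagonal.antidiagonal (n + 1), x p.1 * x p.2 - y p.1 * y p.2
      = x p.1 * (x p.2 - y p.2) + y p.2 * (x p.1 - y p.1) := fun p _ => by ring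
  have e2 : ∑ p ∈ HasAntidiagonal.antidiagonal (n + 1), y p.2 * (x p.1 - y p.1)
      = ∑ p ∈ HasAntidiagonal.antidiagonal (n + 1), y p.1 * (x p.2 - y p.2) :=
    Nat.sum_antidiagonal_swap (f := fun p => y p.1 * (x p.2 - y p.2))
  have hd : ∀ i < n + 1, x i - y i = 0 := fun i hi => sub_eq_zero.mpr (h i (by omega))
  rw [← sum_sub_distrib, sum_congr rfl e, sum_add_distrib, e2,
    sum_antidiagonal_mul_of_eq_zero (y := fun i => x i - y i) hd,
    sum_antidiagonal_mul_of_eq_zero (y := fun i => x i - y i) hd, h 0 (Nat.zero_le _)]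
  ring

/-- The coefficient form of `(α² + βγ)_x = 2α (α_x - (qγ - rβ))` for formal series satisfying the
recursions of `b_i` and `c_i`; here `a'`, `b'`, `c'` stand for the `x`-derivatives. In
particular `α² + βγ` is a first integral as soon as `α_x = qγ - rβ`. -/
theorem sum_antidiagonal_leibniz {a b c a' b' c' : ℕ → R} {q r : R} (hb0 : b 0 = 0)
    (hc0 : c 0 = 0) (hb : ∀ i, b' i = -2 * b (i + 1) - 2 * q * a i)
    (hc : ∀ i, c' i = 2 * c (i + 1) + 2 * r * a i) (n : ℕ) :
    ∑ p ∈ HasAntidiagonal.antidiagonal n,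
        (a p.1 * a' p.2 + a p.2 * a' p.1 + (b p.1 * c' p.2 + c p.2 * b' p.1))
      = 2 * ∑ p ∈ HasAntidiagonal.antidiagonal n, a p.1 * (a' p.2 - (q * c p.2 - r * b p.2)) := by
  have e : ∀ p ∈ HasAntidiagonal.antidiagonal n,
      a p.1 * a' p.2 + a p.2 * a' p.1 + (b p.1 * c' p.2 + c p.2 * b' p.1)
      = a p.1 * a' p.2 + a p.2 * a' p.1 + 2 * (b p.1 * c (p.2 + 1)) - 2 * (b (p.1 + 1) * c p.2)
        + 2 * (r * (a p.2 * b p.1)) - 2 * (q * (a p.1 * c p.2)) := fun p _ => by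
    rw [hb, hc]; ring
  have s1 : ∑ p ∈ HasAntidiagonal.antidiagonal n, a p.2 * a' p.1
      = ∑ p ∈ HasAntidiagonal.antidiagonal n, a p.1 * a' p.2 :=
    Nat.sum_antidiagonal_swap (f := fun p => a p.1 * a' p.2)
  have s2 : ∑ p ∈ HasAntidiagonal.antidiagonal n, a p.2 * b p.1
      = ∑ p ∈ HasAntidiagonal.antidiagonal n, a p.1 * b p.2 :=
    Nat.sum_antidiagonal_swap (f := fun p => a p.1 * b p.2)
  -- the shifted products telescope: both sums are the full convolution of order `n + 1`
  have s3 : ∑ p ∈ HasAntidiagonal.antidiagonal n, b p.1 * c (p.2 + 1)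
      = ∑ p ∈ HasAntidiagonal.antidiagonal n, b (p.1 + 1) * c p.2 := by
    have h1 := Nat.sum_antidiagonal_succ (n := n) (f := fun p => b p.1 * c p.2)
    have h2 := Nat.sum_antidiagonal_succ' (n := n) (f := fun p => b p.1 * c p.2)
    simp only [hb0, hc0, zero_mul, mul_zero, zero_add] at h1 h2
    rw [← h1, ← h2]
  rw [sum_congr rfl e]
  simp only [sum_add_distrib, sum_sub_distrib, mul_sub, ← mul_sum, s1, s2, s3,
    mul_left_comm _ q, mul_left_comm _ r]
  ring

end Convolution

/-! ### The AKNS recursion: `a² + bc = 1` -/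

theorem a_zero : a 0 = -1 := rfl

theorem b_zero : b 0 = 0 := rfl

theorem c_zero : c 0 = 0 := rfl

theorem a_succ (i : ℕ) :
    a (i + 1) = (1 / 2 : ℝ) • invDeriv (qVar * totalDeriv (c i) + rVar * totalDeriv (b i)) := rfl

theorem b_succ (i : ℕ) :
    b (i + 1) = -((1 / 2 : ℝ) • totalDeriv (b i)) - qVar * a i := rfl

theorem c_succ (i : ℕ) : c (i + 1) = (1 / 2 : ℝ) • totalDeriv (c i) - rVar * a i := rfl

theorem two_mul_half_smul (p : DiffPoly) : 2 * ((1 / 2 : ℝ) • p) = p := by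
  rw [two_mul, ← add_smul]
  norm_num

theorem totalDeriv_b (i : ℕ) : totalDeriv (b i) = -2 * b (i + 1) - 2 * qVar * a i := by
  have h := two_mul_half_smul (totalDeriv (b i))
  rw [b_succ]
  linear_combination -h

theorem totalDeriv_c (i : ℕ) : totalDeriv (c i) = 2 * c (i + 1) + 2 * rVar * a i := by
  have h := two_mul_half_smul (totalDeriv (c i))
  rw [c_succ]
  linear_combination -h

theorem constantCoeff_b (i : ℕ) : MvPolynomial.constantCoeff (b i) = 0 := by
  cases i with
  | zero => simp [b_zero]
  | succ i =>
    rw [b_succ, map_sub, map_neg, MvPolynomial.smul_eq_C_mul, map_mul, map_mul,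
      constantCoeff_totalDeriv, qVar, MvPolynomial.constantCoeff_X]
    ring

/-- The coefficient of order `n` of `α² + βγ`, for `α = ∑ a_i t^i`, `β = ∑ b_i t^i` and
`γ = ∑ c_i t^i`. -/
def quad (n : ℕ) : DiffPoly :=
  ∑ p ∈ Finset.HasAntidiagonal.antidiagonal n, (a p.1 * a p.2 + b p.1 * c p.2)

/-- This holds for whatever values `∂⁻¹` takes, since only the recursions of `b_i` and `c_i` enter;
it can therefore be used to show that `∂a_i = q c_i - r b_i`. -/
theorem totalDeriv_quad (n : ℕ) :
    totalDeriv (quad n) = 2 * ∑ p ∈ Finset.HasAntidiagonal.antidiagonal n,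
      a p.1 * (totalDeriv (a p.2) - (qVar * c p.2 - rVar * b p.2)) := by
  rw [← sum_antidiagonal_leibniz (a' := fun i => totalDeriv (a i)) b_zero c_zero
    totalDeriv_b totalDeriv_c,
    quad, map_sum]
  refine Finset.sum_congr rfl fun p _ => ?_
  rw [map_add, Derivation.leibniz, Derivation.leibniz]
  simp only [smul_eq_mul]

theorem constantCoeff_quad {n : ℕ}
    (h : ∀ i < n, MvPolynomial.constantCoeff (a (i + 1)) = 0) :
    MvPolynomial.constantCoeff (quad (n + 1)) = -2 * MvPolynomial.constantCoeff (a (n + 1)) := by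
  have hs : ∀ i ≤ n, MvPolynomial.constantCoeff (a i)
      = (fun j => if j = 0 then (-1 : ℝ) else 0) i := by
    rintro (_ | i) hi
    · simp [a_zero]
    · simp [h i hi]
  have key := sum_antidiagonal_mul_self_sub hs
  have hy : ∑ p ∈ Finset.HasAntidiagonal.antidiagonal (n + 1),
      (fun j => if j = 0 then (-1 : ℝ) else 0) p.1
      * (fun j => if j = 0 then (-1 : ℝ) else 0) p.2 = 0 := by
    refine Finset.sum_eq_zero fun p hp => ?_
    rw [Finset.HasAntidiagonal.mem_antidiagonal] at hp
    by_cases h1 : p.1 = 0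
    · simp [show p.2 ≠ 0 by omega]
    · simp [h1]
  rw [hy] at key
  simp only [quad, map_sum, map_add, map_mul, constantCoeff_b, zero_mul, add_zero]
  rw [sub_zero] at key
  rw [key]
  simp [a_zero]

/-- The argument of `∂⁻¹` in the definition of `a_{n+1}` is a total derivative: in
`quad (n + 1) + 2 a_{n+1}` the contributions of `a_{n+1}` cancel, and by induction this differential
polynomial is an antiderivative of that argument without constant term. -/
theorem totalDeriv_a_and_constantCoeff_a (n : ℕ) :
    totalDeriv (a n) = qVar * c n - rVar * b n ∧
      (0 < n → MvPolynomial.constantCoeff (a n) = 0) := by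
  induction n using Nat.strong_induction_on with
  | _ n ih =>
    cases n with
    | zero => simp [a_zero, b_zero, c_zero]
    | succ n =>
      have hq : totalDeriv (quad (n + 1))
          = -2 * (totalDeriv (a (n + 1)) - (qVar * c (n + 1) - rVar * b (n + 1))) := by
        rw [totalDeriv_quad, sum_antidiagonal_mul_of_eq_zero
          (y := fun i => totalDeriv (a i) - (qVar * c i - rVar * b i))
          fun i hi => sub_eq_zero.mpr (ih i hi).1, a_zero]
        ring
      have harg : qVar * totalDeriv (c n) + rVar * totalDeriv (b n)
          = 2 * (qVar * c (n + 1) - rVar * b (n + 1)) := by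
        rw [totalDeriv_b, totalDeriv_c]
        ring
      have hinv := totalDeriv_invDeriv (p := 2 * (qVar * c (n + 1) - rVar * b (n + 1)))
        (g := quad (n + 1) + (2 : ℝ) • a (n + 1)) (by
          rw [map_add, hq, Derivation.map_smul, MvPolynomial.smul_eq_C_mul, map_ofNat]
          ring) (by
          rw [map_add, constantCoeff_quad fun i hi => (ih (i + 1) (by omega)).2 i.succ_pos,
            MvPolynomial.smul_eq_C_mul, map_mul, MvPolynomial.constantCoeff_C]
          ring)
      rw [a_succ, harg, Derivation.map_smul, hinv.1, MvPolynomial.smul_eq_C_mul,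
        MvPolynomial.smul_eq_C_mul, map_mul, hinv.2]
      refine ⟨?_, fun _ => mul_zero _⟩
      rw [← MvPolynomial.smul_eq_C_mul, ← mul_smul_comm, two_mul_half_smul]

theorem totalDeriv_a (n : ℕ) : totalDeriv (a n) = qVar * c n - rVar * b n :=
  (totalDeriv_a_and_constantCoeff_a n).1

theorem quad_succ (n : ℕ) : quad (n + 1) = 0 := by
  refine eq_zero_of_totalDeriv_eq_zero ?_ ?_
  · rw [totalDeriv_quad, Finset.sum_eq_zero, mul_zero]
    intro p _
    rw [totalDeriv_a, sub_self, mul_zero]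
  · rw [constantCoeff_quad fun i _ => (totalDeriv_a_and_constantCoeff_a (i + 1)).2 i.succ_pos,
      (totalDeriv_a_and_constantCoeff_a (n + 1)).2 n.succ_pos, mul_zero]

/-! ### The series `I = (F / 4)^(-1/2)` -/

open PowerSeries in
theorem sum_antidiagonalTuple_prod_eq_coeff_pow {R : Type*} [CommRing R] (g : PowerSeries R)
    (n m : ℕ) :
    ∑ t ∈ Finset.Nat.antidiagonalTuple n m, ∏ k, coeff (t k) g = coeff m (g ^ n) := by
  have h := coeff_prod (fun _ : Fin n => g) m Finset.univ
  rw [Finset.prod_const, Finset.card_univ, Fintype.card_fin] at h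
  rw [h]
  refine Finset.sum_equiv Finsupp.equivFunOnFinite.symm (fun t => ?_) fun t _ => ?_
  · simp [Finset.Nat.mem_antidiagonalTuple]
  · simp

/-- The coefficient form of `d(y)² (1 + y / 4) = 1` for `d(y) = ∑ d_n y^n`. -/
theorem d_conv (n : ℕ) :
    ∑ p ∈ Finset.HasAntidiagonal.antidiagonal (n + 1), d p.1 * d p.2
      + 1 / 4 * ∑ p ∈ Finset.HasAntidiagonal.antidiagonal n, d p.1 * d p.2 = 0 := by
  match n with
  | 0 => simp [Finset.Nat.sum_antidiagonal_succ, d]; norm_num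
  | 1 => simp [Finset.Nat.sum_antidiagonal_succ, d]; norm_num
  | n + 2 =>
    have h3 : ∑ p ∈ Finset.HasAntidiagonal.antidiagonal (n + 3), d p.1 * d p.2
        = 2 * d (n + 3) + ∑ i ∈ Finset.range (n + 2), d (i + 1) * d (n + 2 - i) := by
      rw [Finset.Nat.sum_antidiagonal_succ, Finset.Nat.sum_antidiagonal_succ',
        Finset.Nat.sum_antidiagonal_eq_sum_range_succ_mk, d]
      have : ∀ i ∈ Finset.range (n + 2), d (i + 1) * d (n + 1 - i + 1)
          = d (i + 1) * d (n + 2 - i) := fun i hi => by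
        rw [Finset.mem_range] at hi
        rw [show n + 1 - i + 1 = n + 2 - i by omega]
      rw [Finset.sum_congr rfl this]
      ring
    have h2 : ∑ p ∈ Finset.HasAntidiagonal.antidiagonal (n + 2), d p.1 * d p.2
        = 2 * d (n + 2) + ∑ i ∈ Finset.range (n + 1), d (i + 1) * d (n + 1 - i) := by
      rw [Finset.Nat.sum_antidiagonal_succ, Finset.Nat.sum_antidiagonal_succ',
        Finset.Nat.sum_antidiagonal_eq_sum_range_succ_mk, d]
      have : ∀ i ∈ Finset.range (n + 1), d (i + 1) * d (n - i + 1)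
          = d (i + 1) * d (n + 1 - i) := fun i hi => by
        rw [Finset.mem_range] at hi
        rw [show n - i + 1 = n + 1 - i by omega]
      rw [Finset.sum_congr rfl this]
      ring
    have hr : d (n + 3) = -(1 / 2) * ∑ i ∈ Finset.range (n + 2), d (i + 1) * d (n + 2 - i)
        - 1 / 4 * d (n + 2)
        - 1 / 8 * ∑ i ∈ Finset.range (n + 1), d (i + 1) * d (n + 1 - i) := by
      rw [d, Fin.sum_univ_eq_sum_range (fun i => d (i + 1) * d (n + 2 - i)),
        Fin.sum_univ_eq_sum_range (fun i => d (i + 1) * d (n + 1 - i))]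
    rw [h3, h2, hr]
    ring

open PowerSeries in
theorem mk_d_sq_mul : mk d * mk d * (1 + C (1 / 4 : ℝ) * X) = 1 := by
  ext n
  cases n with
  | zero => simp [d]
  | succ n =>
    have h := d_conv n
    rw [mul_add, mul_one, mul_left_comm, map_add, coeff_C_mul, coeff_succ_mul_X, coeff_mul,
      coeff_mul]
    simpa [coeff_one] using h

section Series

variable {N : ℕ} (lam mu : Fin N → ℝ) (P Q : Fin 3 → Fin N → ℝ)

theorem I_succ (m : ℕ) : I lam mu P Q (m + 1) = ∑ n ∈ Finset.Icc 1 (m + 1), d n *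
      ∑ t ∈ (Finset.Nat.antidiagonalTuple n (m + 1)).filter (fun t => ∀ k, 1 ≤ t k),
        ∏ k, F lam mu P Q (t k) := rfl

open PowerSeries in
/-- The series `∑ I_m t^m` is the composition of `∑ d_n y^n` with `y = ∑_{m ≥ 1} F_m t^m`. -/
theorem mk_I : mk (I lam mu P Q) = (mk d).subst (mk (F lam mu P Q) - C 4) := by
  set g : PowerSeries ℝ := mk (F lam mu P Q) - C 4 with hg
  have hg0 : constantCoeff g = 0 := by simp [hg, F]
  have hgs : ∀ k, 1 ≤ k → coeff k g = F lam mu P Q k := fun k hk => by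
    rw [hg, map_sub, coeff_mk, coeff_C, if_neg (by omega), sub_zero]
  ext m
  rw [coeff_subst' (HasSubst.of_constantCoeff_zero' hg0), coeff_mk]
  -- `g` has order at least one, so `g ^ n` contributes nothing at order `m < n`
  have hsupp : (Function.support fun n => coeff n (mk d) • coeff m (g ^ n))
      ⊆ Finset.range (m + 1) := by
    intro n hn
    by_contra hlt
    refine hn ?_
    have hmn : m < n := by simpa using hlt
    simp [coeff_of_lt_order m (lt_of_lt_of_le (Nat.cast_lt.mpr hmn)
      (le_order_pow_of_constantCoeff_eq_zero n hg0))]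
  rw [finsum_eq_sum_of_support_subset _ hsupp]
  cases m with
  | zero => simp [I, d]
  | succ m =>
    rw [I_succ, Finset.range_eq_Ico, Finset.sum_eq_sum_Ico_succ_bot (by omega)]
    simp only [coeff_mk, smul_eq_mul, pow_zero, coeff_one, Nat.succ_ne_zero, if_false, mul_zero,
      zero_add]
    refine Finset.sum_congr rfl fun n _ => ?_
    rw [← sum_antidiagonalTuple_prod_eq_coeff_pow, Finset.sum_filter]
    congr 1
    refine Finset.sum_congr rfl fun t _ => ?_
    -- tuples with an entry `0` drop out because the constant coefficient of `g` vanishes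
    split_ifs with ht
    · exact Finset.prod_congr rfl fun k _ => (hgs _ (ht k)).symm
    · push Not at ht
      obtain ⟨k, hk⟩ := ht
      refine (Finset.prod_eq_zero (Finset.mem_univ k) ?_).symm
      rw [Nat.lt_one_iff.mp hk, coeff_zero_eq_constantCoeff_apply, hg0]

open PowerSeries in
/-- `I² (F / 4) = 1`: the substitution `y = F - 4` in `d(y)² (1 + y / 4) = 1`. -/
theorem mk_I_sq_mul : mk (I lam mu P Q) * mk (I lam mu P Q)
    * (C (1 / 4 : ℝ) * mk (F lam mu P Q)) = 1 := by
  set g : PowerSeries ℝ := mk (F lam mu P Q) - C 4 with hg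
  have hs : HasSubst g := HasSubst.of_constantCoeff_zero' (by simp [hg, F])
  have h := congrArg (substAlgHom hs) mk_d_sq_mul
  rw [map_mul, map_mul, map_add, map_mul, map_one, substAlgHom_X,
    show (C (1 / 4 : ℝ) : PowerSeries ℝ) = algebraMap ℝ _ (1 / 4) from rfl, AlgHom.commutes,
    coe_substAlgHom, ← mk_I] at h
  rw [← h]
  congr 1
  rw [hg, show (algebraMap ℝ (PowerSeries ℝ) (1 / 4)) = C (1 / 4 : ℝ) from rfl, mul_sub,
    ← map_mul]
  norm_num

/-! ### The hatted sequences -/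

/-- The coefficients of `-1 + ∑ (⟨A^k P_1, B Q_1⟩ - ⟨A^k P_3, B Q_3⟩) t^(k+1)`. -/
def hatA : ℕ → ℝ
  | 0 => -1
  | k + 1 => pairA lam mu k P Q

/-- The coefficients of `√2 ∑ (⟨A^k P_1, B Q_2⟩ + ⟨A^k P_2, B Q_3⟩) t^(k+1)`. -/
def hatB : ℕ → ℝ
  | 0 => 0
  | k + 1 => √2 * pairB lam mu k P Q

/-- The coefficients of `√2 ∑ (⟨A^k P_2, B Q_1⟩ + ⟨A^k P_3, B Q_2⟩) t^(k+1)`. -/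
def hatC : ℕ → ℝ
  | 0 => 0
  | k + 1 => √2 * pairC lam mu k P Q

/-- The functions `F_m` are four times the coefficients of `α̂² + β̂γ̂`. -/
theorem F_eq (m : ℕ) : F lam mu P Q m = 4 * ∑ p ∈ Finset.HasAntidiagonal.antidiagonal m,
    (hatA lam mu P Q p.1 * hatA lam mu P Q p.2 + hatB lam mu P Q p.1 * hatC lam mu P Q p.2) := by
  match m with
  | 0 => simp [F, hatA, hatB]
  | 1 =>
    simp [F, Finset.Nat.sum_antidiagonal_succ, hatA, hatB, hatC]
    ring
  | m + 2 =>
    rw [Finset.Nat.sum_antidiagonal_succ, Finset.Nat.sum_antidiagonal_succ',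
      Finset.Nat.sum_antidiagonal_eq_sum_range_succ_mk, F, ← Finset.Ico_add_one_right_eq_Icc,
      Finset.sum_Ico_eq_sum_range]
    have h2 : √2 * √2 = (2 : ℝ) := Real.mul_self_sqrt (by norm_num)
    have : ∀ i ∈ Finset.range (m + 1), pairA lam mu (1 + i - 1) P Q
        * pairA lam mu (m + 2 - (1 + i) - 1) P Q
        + 2 * pairB lam mu (1 + i - 1) P Q * pairC lam mu (m + 2 - (1 + i) - 1) P Q
        = hatA lam mu P Q (i + 1) * hatA lam mu P Q (m - i + 1)
          + hatB lam mu P Q (i + 1) * hatC lam mu P Q (m - i + 1) := fun i hi => by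
      rw [Finset.mem_range] at hi
      rw [show 1 + i - 1 = i by omega, show m + 2 - (1 + i) - 1 = m - i by omega, hatA, hatA,
        hatB, hatC]
      linear_combination -(pairB lam mu i P Q * pairC lam mu (m - i) P Q) * h2
    rw [show m + 1 + 1 - 1 = m + 1 by omega, Finset.sum_congr rfl this]
    simp only [hatA, hatB, hatC]
    ring

open PowerSeries in
theorem mk_F : C (1 / 4 : ℝ) * mk (F lam mu P Q)
    = mk (hatA lam mu P Q) * mk (hatA lam mu P Q) + mk (hatB lam mu P Q) * mk (hatC lam mu P Q) := by
  ext m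
  rw [coeff_C_mul, coeff_mk, F_eq, map_add, coeff_mul, coeff_mul, Finset.sum_add_distrib]
  simp only [coeff_mk]
  ring

end Series

/-! ### Differential polynomials along smooth potentials -/

open scoped ContDiff

theorem hasDerivAt_iteratedDeriv {J : Set ℝ} (hJ : IsOpen J) {f : ℝ → ℝ}
    (hf : ContDiffOn ℝ ∞ f J) (k : ℕ) {x : ℝ} (hx : x ∈ J) :
    HasDerivAt (iteratedDeriv k f) (iteratedDeriv (k + 1) f x) x := by
  rw [iteratedDeriv_succ, hasDerivAt_deriv_iff]
  have h := hf.differentiableOn_iteratedDerivWithin (m := k) (by exact_mod_cast ENat.natCast_lt_top k)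
    hJ.uniqueDiffOn
  have h' := (h x hx).differentiableAt (hJ.mem_nhds hx)
  exact h'.congr_of_eventuallyEq
    ((iteratedDerivWithin_of_isOpen hJ).symm.eventuallyEq_of_mem (hJ.mem_nhds hx))

theorem hasDerivAt_evalAt {J : Set ℝ} (hJ : IsOpen J) {q r : ℝ → ℝ}
    (hq : ContDiffOn ℝ ∞ q J) (hr : ContDiffOn ℝ ∞ r J) (p : DiffPoly) {x : ℝ} (hx : x ∈ J) :
    HasDerivAt (evalAt q r p) (evalAt q r (totalDeriv p) x) x := by
  induction p using MvPolynomial.induction_on with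
  | C s =>
    have h : evalAt q r (MvPolynomial.C s) = fun _ => s := by ext; simp [evalAt]
    rw [h, MvPolynomial.derivation_C]
    simpa [evalAt] using hasDerivAt_const x s
  | add p p' hp hp' =>
    have h : evalAt q r (p + p') = evalAt q r p + evalAt q r p' := by ext; simp [evalAt]
    rw [h, map_add]
    exact (hp.add hp').congr_deriv (by simp [evalAt])
  | mul_X p v hp =>
    have hv : HasDerivAt (iteratedDeriv v.2 (![q, r] v.1))
        (iteratedDeriv (v.2 + 1) (![q, r] v.1) x) x := by
      refine hasDerivAt_iteratedDeriv hJ ?_ _ hx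
      obtain ⟨i, k⟩ := v
      fin_cases i
      · exact hq
      · exact hr
    have h : evalAt q r (p * MvPolynomial.X v)
        = evalAt q r p * iteratedDeriv v.2 (![q, r] v.1) := by ext; simp [evalAt]
    rw [h, Derivation.leibniz, totalDeriv_X]
    refine (hp.mul hv).congr_deriv ?_
    simp only [evalAt, smul_eq_mul, map_add, map_mul, MvPolynomial.eval_X]
    ring

/-! ### The nonlinearized spatial flow -/

section Flow

variable {N : ℕ} {lam mu : Fin N → ℝ} {J : Set ℝ} {P Q : ℝ → Fin 3 → Fin N → ℝ}

theorem pair_eq_sum (lam mu : Fin N → ℝ) (k : ℕ) (v w : Fin N → ℝ) :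
    pair lam mu k v w = ∑ j, lam j ^ k * mu j * (v j * w j) := by
  rw [pair, Matrix.diagonal_pow, dotProduct]
  refine Finset.sum_congr rfl fun j _ => ?_
  rw [Matrix.mulVec_diagonal, Matrix.mulVec_diagonal, Pi.pow_apply]
  ring

theorem pairA_eq_sum (lam mu : Fin N → ℝ) (k : ℕ) (P Q : Fin 3 → Fin N → ℝ) :
    pairA lam mu k P Q = ∑ j, lam j ^ k * mu j * (P 0 j * Q 0 j - P 2 j * Q 2 j) := by
  simp only [pairA, pair_eq_sum, mul_sub, Finset.sum_sub_distrib]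

theorem pairB_eq_sum (lam mu : Fin N → ℝ) (k : ℕ) (P Q : Fin 3 → Fin N → ℝ) :
    pairB lam mu k P Q = ∑ j, lam j ^ k * mu j * (P 0 j * Q 1 j + P 1 j * Q 2 j) := by
  simp only [pairB, pair_eq_sum, mul_add, Finset.sum_add_distrib]

theorem pairC_eq_sum (lam mu : Fin N → ℝ) (k : ℕ) (P Q : Fin 3 → Fin N → ℝ) :
    pairC lam mu k P Q = ∑ j, lam j ^ k * mu j * (P 1 j * Q 0 j + P 2 j * Q 1 j) := by
  simp only [pairC, pair_eq_sum, mul_add, Finset.sum_add_distrib]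

theorem IsSpatialSolution.hasDerivAt_P (hsol : IsSpatialSolution lam mu J P Q) {x : ℝ}
    (hx : x ∈ J) (j : Fin N) (i : Fin 3) : HasDerivAt (fun y => P y i j)
      (![-2 * lam j * P x 0 j + √2 * qPot lam mu (P x) (Q x) * P x 1 j,
        √2 * rPot lam mu (P x) (Q x) * P x 0 j + √2 * qPot lam mu (P x) (Q x) * P x 2 j,
        √2 * rPot lam mu (P x) (Q x) * P x 1 j + 2 * lam j * P x 2 j] i) x := by
  refine (hasDerivAt_pi.mp (hsol x hx j).1 i).congr_deriv ?_
  fin_cases i <;> simp [U, Matrix.mulVec, dotProduct, Fin.sum_univ_three]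

theorem IsSpatialSolution.hasDerivAt_Q (hsol : IsSpatialSolution lam mu J P Q) {x : ℝ}
    (hx : x ∈ J) (j : Fin N) (i : Fin 3) : HasDerivAt (fun y => Q y i j)
      (![2 * lam j * Q x 0 j - √2 * rPot lam mu (P x) (Q x) * Q x 1 j,
        -(√2 * qPot lam mu (P x) (Q x) * Q x 0 j) - √2 * rPot lam mu (P x) (Q x) * Q x 2 j,
        -(√2 * qPot lam mu (P x) (Q x) * Q x 1 j) - 2 * lam j * Q x 2 j] i) x := by
  refine (hasDerivAt_pi.mp (hsol x hx j).2 i).congr_deriv ?_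
  fin_cases i <;> simp [U, Matrix.mulVec, dotProduct, Fin.sum_univ_three, sub_eq_add_neg, add_comm]

theorem contDiffOn_qPot {n : ℕ} (hP : ∀ i j, ContDiffOn ℝ n (fun y => P y i j) J)
    (hQ : ∀ i j, ContDiffOn ℝ n (fun y => Q y i j) J) :
    ContDiffOn ℝ n (fun y => qPot lam mu (P y) (Q y)) J := by
  simp only [qPot, pairB_eq_sum]
  exact contDiffOn_const.mul (ContDiffOn.sum fun j _ => contDiffOn_const.mul
    (((hP 0 j).mul (hQ 1 j)).add ((hP 1 j).mul (hQ 2 j))))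

theorem contDiffOn_rPot {n : ℕ} (hP : ∀ i j, ContDiffOn ℝ n (fun y => P y i j) J)
    (hQ : ∀ i j, ContDiffOn ℝ n (fun y => Q y i j) J) :
    ContDiffOn ℝ n (fun y => rPot lam mu (P y) (Q y)) J := by
  simp only [rPot, pairC_eq_sum]
  exact contDiffOn_const.mul (ContDiffOn.sum fun j _ => contDiffOn_const.mul
    (((hP 1 j).mul (hQ 0 j)).add ((hP 2 j).mul (hQ 1 j))))

theorem contDiffOn_succ_of_hasDerivAt (hJ : IsOpen J) {n : ℕ} {f f' : ℝ → ℝ}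
    (h : ∀ x ∈ J, HasDerivAt f (f' x) x) (hf' : ContDiffOn ℝ n f' J) :
    ContDiffOn ℝ (n + 1 : ℕ) f J := by
  rw [Nat.cast_succ, contDiffOn_succ_iff_deriv_of_isOpen hJ]
  refine ⟨fun x hx => (h x hx).differentiableAt.differentiableWithinAt, by simp, ?_⟩
  exact hf'.congr fun x hx => (h x hx).deriv

/-- Bootstrapping: the right-hand sides of the spatial system are as smooth as `(P, Q)`. -/
theorem IsSpatialSolution.contDiffOn (hJ : IsOpen J) (hsol : IsSpatialSolution lam mu J P Q)
    (n : ℕ) : (∀ i j, ContDiffOn ℝ n (fun y => P y i j) J) ∧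
      ∀ i j, ContDiffOn ℝ n (fun y => Q y i j) J := by
  induction n with
  | zero =>
    simp only [Nat.cast_zero, contDiffOn_zero]
    exact ⟨fun i j x hx => (hsol.hasDerivAt_P hx j i).continuousAt.continuousWithinAt,
      fun i j x hx => (hsol.hasDerivAt_Q hx j i).continuousAt.continuousWithinAt⟩
  | succ n ih =>
    obtain ⟨hP, hQ⟩ := ih
    have hq := contDiffOn_qPot (lam := lam) (mu := mu) hP hQ
    have hr := contDiffOn_rPot (lam := lam) (mu := mu) hP hQ
    refine ⟨fun i j => contDiffOn_succ_of_hasDerivAt hJ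
      (fun x hx => hsol.hasDerivAt_P hx j i) ?_, fun i j => contDiffOn_succ_of_hasDerivAt hJ
      (fun x hx => hsol.hasDerivAt_Q hx j i) ?_⟩
    · have h0 := hP 0 j
      have h1 := hP 1 j
      have h2 := hP 2 j
      fin_cases i
      · exact (contDiffOn_const.mul h0).add ((contDiffOn_const.mul hq).mul h1)
      · exact ((contDiffOn_const.mul hr).mul h0).add ((contDiffOn_const.mul hq).mul h2)
      · exact ((contDiffOn_const.mul hr).mul h1).add (contDiffOn_const.mul h2)
    · have h0 := hQ 0 j
      have h1 := hQ 1 j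
      have h2 := hQ 2 j
      fin_cases i
      · exact (contDiffOn_const.mul h0).sub ((contDiffOn_const.mul hr).mul h1)
      · exact ((contDiffOn_const.mul hq).mul h0).neg.sub ((contDiffOn_const.mul hr).mul h2)
      · exact ((contDiffOn_const.mul hq).mul h1).neg.sub (contDiffOn_const.mul h2)

theorem IsSpatialSolution.hasDerivAt_tilde (hJ : IsOpen J)
    (hsol : IsSpatialSolution lam mu J P Q) (Z : DiffPoly) {x : ℝ} (hx : x ∈ J) :
    HasDerivAt (tilde lam mu P Q Z) (tilde lam mu P Q (totalDeriv Z) x) x :=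
  hasDerivAt_evalAt hJ
    (contDiffOn_infty.mpr fun n =>
      contDiffOn_qPot (hsol.contDiffOn hJ n).1 (hsol.contDiffOn hJ n).2)
    (contDiffOn_infty.mpr fun n =>
      contDiffOn_rPot (hsol.contDiffOn hJ n).1 (hsol.contDiffOn hJ n).2) Z hx

theorem IsSpatialSolution.hasDerivAt_hatA (hsol : IsSpatialSolution lam mu J P Q) {x : ℝ}
    (hx : x ∈ J) (k : ℕ) : HasDerivAt (fun y => hatA lam mu (P y) (Q y) k)
      (qPot lam mu (P x) (Q x) * hatC lam mu (P x) (Q x) k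
        - rPot lam mu (P x) (Q x) * hatB lam mu (P x) (Q x) k) x := by
  cases k with
  | zero => simpa [hatA, hatB, hatC] using hasDerivAt_const x (-1 : ℝ)
  | succ k =>
    simp only [hatA, hatB, hatC, pairA_eq_sum]
    rw [pairB_eq_sum, pairC_eq_sum]
    have h := HasDerivAt.fun_sum (u := Finset.univ) fun (j : Fin N) _ =>
      (((hsol.hasDerivAt_P hx j 0).fun_mul (hsol.hasDerivAt_Q hx j 0)).fun_sub
        ((hsol.hasDerivAt_P hx j 2).fun_mul (hsol.hasDerivAt_Q hx j 2))).const_mul (lam j ^ k * mu j)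
    refine h.congr_deriv ?_
    simp only [Finset.mul_sum, ← Finset.sum_sub_distrib]
    refine Finset.sum_congr rfl fun j _ => ?_
    simp
    ring

/-- The recursion of `b_i`, also at order zero: there it is `0 = -2 q + 2 q`, because
`hatB 1 = √2 * pairB 0` is the potential `q`. -/
theorem IsSpatialSolution.hasDerivAt_hatB (hsol : IsSpatialSolution lam mu J P Q) {x : ℝ}
    (hx : x ∈ J) (k : ℕ) : HasDerivAt (fun y => hatB lam mu (P y) (Q y) k)
      (-2 * hatB lam mu (P x) (Q x) (k + 1)
        - 2 * qPot lam mu (P x) (Q x) * hatA lam mu (P x) (Q x) k) x := by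
  cases k with
  | zero =>
    refine (hasDerivAt_const x (0 : ℝ)).congr_deriv ?_
    simp [hatA, hatB, qPot]
  | succ k =>
    simp only [hatA, hatB, pairB_eq_sum]
    rw [pairA_eq_sum]
    have h := (HasDerivAt.fun_sum (u := Finset.univ) fun (j : Fin N) _ =>
      (((hsol.hasDerivAt_P hx j 0).fun_mul (hsol.hasDerivAt_Q hx j 1)).fun_add
        ((hsol.hasDerivAt_P hx j 1).fun_mul (hsol.hasDerivAt_Q hx j 2))).const_mul
          (lam j ^ k * mu j)).const_mul √2
    refine h.congr_deriv ?_
    simp only [Finset.mul_sum, ← Finset.sum_sub_distrib]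
    have h2 : √2 * √2 = (2 : ℝ) := Real.mul_self_sqrt (by norm_num)
    refine Finset.sum_congr rfl fun j _ => ?_
    simp only [Matrix.cons_val]
    linear_combination -(qPot lam mu (P x) (Q x) * (lam j ^ k * mu j *
      (P x 0 j * Q x 0 j - P x 2 j * Q x 2 j))) * h2

theorem IsSpatialSolution.hasDerivAt_hatC (hsol : IsSpatialSolution lam mu J P Q) {x : ℝ}
    (hx : x ∈ J) (k : ℕ) : HasDerivAt (fun y => hatC lam mu (P y) (Q y) k)
      (2 * hatC lam mu (P x) (Q x) (k + 1)
        + 2 * rPot lam mu (P x) (Q x) * hatA lam mu (P x) (Q x) k) x := by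
  cases k with
  | zero =>
    refine (hasDerivAt_const x (0 : ℝ)).congr_deriv ?_
    simp [hatA, hatC, rPot]
  | succ k =>
    simp only [hatA, hatC, pairC_eq_sum]
    rw [pairA_eq_sum]
    have h := (HasDerivAt.fun_sum (u := Finset.univ) fun (j : Fin N) _ =>
      (((hsol.hasDerivAt_P hx j 1).fun_mul (hsol.hasDerivAt_Q hx j 0)).fun_add
        ((hsol.hasDerivAt_P hx j 2).fun_mul (hsol.hasDerivAt_Q hx j 1))).const_mul
          (lam j ^ k * mu j)).const_mul √2
    refine h.congr_deriv ?_
    simp only [Finset.mul_sum, ← Finset.sum_add_distrib]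
    have h2 : √2 * √2 = (2 : ℝ) := Real.mul_self_sqrt (by norm_num)
    refine Finset.sum_congr rfl fun j _ => ?_
    simp only [Matrix.cons_val]
    linear_combination (rPot lam mu (P x) (Q x) * (lam j ^ k * mu j *
      (P x 0 j * Q x 0 j - P x 2 j * Q x 2 j))) * h2

/-- The functions `F_m` are first integrals of the spatial system. -/
theorem IsSpatialSolution.hasDerivAt_F (hsol : IsSpatialSolution lam mu J P Q) {x : ℝ}
    (hx : x ∈ J) (m : ℕ) : HasDerivAt (fun y => F lam mu (P y) (Q y) m) 0 x := by
  simp only [F_eq]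
  have h := (HasDerivAt.fun_sum (u := Finset.HasAntidiagonal.antidiagonal m) fun (p : ℕ × ℕ) _ =>
    ((hsol.hasDerivAt_hatA hx p.1).fun_mul (hsol.hasDerivAt_hatA hx p.2)).fun_add
      ((hsol.hasDerivAt_hatB hx p.1).fun_mul (hsol.hasDerivAt_hatC hx p.2))).const_mul 4
  refine h.congr_deriv ?_
  have key := sum_antidiagonal_leibniz (a := hatA lam mu (P x) (Q x))
    (b := hatB lam mu (P x) (Q x)) (c := hatC lam mu (P x) (Q x))
    (a' := fun k => qPot lam mu (P x) (Q x) * hatC lam mu (P x) (Q x) k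
        - rPot lam mu (P x) (Q x) * hatB lam mu (P x) (Q x) k)
    (q := qPot lam mu (P x) (Q x)) (r := rPot lam mu (P x) (Q x)) rfl rfl (fun _ => rfl)
    (fun _ => rfl) m
  simp only [sub_self, mul_zero, Finset.sum_const_zero] at key
  refine mul_eq_zero_of_right _ (Eq.trans ?_ key)
  exact Finset.sum_congr rfl fun p _ => by ring

theorem IsSpatialSolution.hasDerivAt_I (hsol : IsSpatialSolution lam mu J P Q) {x : ℝ}
    (hx : x ∈ J) (m : ℕ) : HasDerivAt (fun y => I lam mu (P y) (Q y) m) 0 x := by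
  cases m with
  | zero => exact hasDerivAt_const x 1
  | succ m =>
    simp only [I_succ]
    have h := HasDerivAt.fun_sum (u := Finset.Icc 1 (m + 1)) fun n _ =>
      (HasDerivAt.fun_sum (u := (Finset.Nat.antidiagonalTuple n (m + 1)).filter
        (fun t => ∀ k, 1 ≤ t k)) fun t _ =>
        HasDerivAt.fun_finsetProd (u := Finset.univ) fun k _ =>
          hsol.hasDerivAt_F hx (t k)).const_mul (d n)
    refine h.congr_deriv ?_
    simp

end Flow

/-! ### Comparison with the AKNS quantities -/

section Comparison

variable {N : ℕ} {lam mu : Fin N → ℝ} {J : Set ℝ} {P Q : ℝ → Fin 3 → Fin N → ℝ}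

theorem tilde_add (Z W : DiffPoly) (x : ℝ) :
    tilde lam mu P Q (Z + W) x = tilde lam mu P Q Z x + tilde lam mu P Q W x :=
  map_add _ _ _

theorem tilde_mul (Z W : DiffPoly) (x : ℝ) :
    tilde lam mu P Q (Z * W) x = tilde lam mu P Q Z x * tilde lam mu P Q W x :=
  map_mul _ _ _

theorem tilde_qVar (x : ℝ) : tilde lam mu P Q qVar x = qPot lam mu (P x) (Q x) := by
  simp [tilde, evalAt, qVar]

theorem tilde_rVar (x : ℝ) : tilde lam mu P Q rVar x = rPot lam mu (P x) (Q x) := by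
  simp [tilde, evalAt, rVar]

theorem tilde_b_succ (m : ℕ) (x : ℝ) : tilde lam mu P Q (b (m + 1)) x
    = -(1 / 2) * tilde lam mu P Q (totalDeriv (b m)) x
      - qPot lam mu (P x) (Q x) * tilde lam mu P Q (a m) x := by
  rw [← tilde_qVar (lam := lam) (mu := mu) (P := P) (Q := Q), b_succ]
  simp [tilde, evalAt]

theorem tilde_c_succ (m : ℕ) (x : ℝ) : tilde lam mu P Q (c (m + 1)) x
    = 1 / 2 * tilde lam mu P Q (totalDeriv (c m)) x
      - rPot lam mu (P x) (Q x) * tilde lam mu P Q (a m) x := by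
  rw [← tilde_rVar (lam := lam) (mu := mu) (P := P) (Q := Q), c_succ]
  simp [tilde, evalAt]

theorem sum_antidiagonal_tilde (n : ℕ) (x : ℝ) :
    ∑ p ∈ Finset.HasAntidiagonal.antidiagonal (n + 1),
        tilde lam mu P Q (a p.1) x * tilde lam mu P Q (a p.2) x
      + ∑ p ∈ Finset.HasAntidiagonal.antidiagonal (n + 1),
        tilde lam mu P Q (b p.1) x * tilde lam mu P Q (c p.2) x = 0 := by
  have h : tilde lam mu P Q (quad (n + 1)) x = 0 := by
    rw [quad_succ]
    exact map_zero _
  rw [← h, ← Finset.sum_add_distrib]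
  refine Eq.trans (Finset.sum_congr rfl fun p _ => ?_) (map_sum _ _ _).symm
  exact ((tilde_add _ _ _).trans (congrArg₂ _ (tilde_mul _ _ _) (tilde_mul _ _ _))).symm

variable (lam mu) in
/-- The coefficient of order `m` of the product of `∑ I_i t^i` and `∑ s_i t^i`. -/
def convI (P Q : Fin 3 → Fin N → ℝ) (s : ℕ → ℝ) (m : ℕ) : ℝ :=
  ∑ p ∈ Finset.HasAntidiagonal.antidiagonal m, I lam mu P Q p.1 * s p.2

theorem convI_succ (P Q : Fin 3 → Fin N → ℝ) (s : ℕ → ℝ) (m : ℕ) :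
    convI lam mu P Q s (m + 1) = I lam mu P Q (m + 1) * s 0
      + ∑ i ∈ Finset.range (m + 1), I lam mu P Q i * s (m - i + 1) := by
  rw [convI, Finset.Nat.sum_antidiagonal_succ', Finset.Nat.sum_antidiagonal_eq_sum_range_succ_mk]

open PowerSeries in
theorem mk_convI (P Q : Fin 3 → Fin N → ℝ) (s : ℕ → ℝ) :
    mk (convI lam mu P Q s) = mk (I lam mu P Q) * mk s := by
  ext m
  simp [coeff_mul, convI]

/-- The products of `∑ I_i t^i` with the hatted series satisfy the normalization
`α² + βγ = 1` of the AKNS quantities. -/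
theorem sum_antidiagonal_convI (P Q : Fin 3 → Fin N → ℝ) (n : ℕ) :
    ∑ p ∈ Finset.HasAntidiagonal.antidiagonal (n + 1),
        convI lam mu P Q (hatA lam mu P Q) p.1 * convI lam mu P Q (hatA lam mu P Q) p.2
      + ∑ p ∈ Finset.HasAntidiagonal.antidiagonal (n + 1),
        convI lam mu P Q (hatB lam mu P Q) p.1 * convI lam mu P Q (hatC lam mu P Q) p.2 = 0 := by
  have h := mk_I_sq_mul lam mu P Q
  rw [mk_F] at h
  have h' := congrArg (PowerSeries.coeff (n + 1)) ((show
    PowerSeries.mk (convI lam mu P Q (hatA lam mu P Q))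
      * PowerSeries.mk (convI lam mu P Q (hatA lam mu P Q))
      + PowerSeries.mk (convI lam mu P Q (hatB lam mu P Q))
      * PowerSeries.mk (convI lam mu P Q (hatC lam mu P Q)) = _ by
    rw [mk_convI, mk_convI, mk_convI]; ring).trans h)
  rw [map_add, PowerSeries.coeff_mul, PowerSeries.coeff_mul, PowerSeries.coeff_one,
    if_neg n.succ_ne_zero] at h'
  simpa only [PowerSeries.coeff_mk] using h'

theorem IsSpatialSolution.hasDerivAt_convI (hsol : IsSpatialSolution lam mu J P Q) {x : ℝ}
    (hx : x ∈ J) {s : ℝ → ℕ → ℝ} {s' : ℕ → ℝ} (hs : ∀ k, HasDerivAt (fun y => s y k) (s' k) x)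
    (m : ℕ) : HasDerivAt (fun y => convI lam mu (P y) (Q y) (s y) m)
      (convI lam mu (P x) (Q x) s' m) x := by
  refine (HasDerivAt.fun_sum fun p _ =>
    (hsol.hasDerivAt_I hx p.1).fun_mul (hs p.2)).congr_deriv ?_
  exact Finset.sum_congr rfl fun p _ => by ring

/-- Both sides satisfy the same recursions for `b` and `c`, because `I_x = 0`, and the
normalization `α² + βγ = 1` determines `a_m` from the preceding coefficients. -/
theorem IsSpatialSolution.tilde_eq_convI (hJ : IsOpen J)
    (hsol : IsSpatialSolution lam mu J P Q) (m : ℕ) : ∀ x ∈ J,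
      tilde lam mu P Q (a m) x = convI lam mu (P x) (Q x) (hatA lam mu (P x) (Q x)) m ∧
      tilde lam mu P Q (b m) x = convI lam mu (P x) (Q x) (hatB lam mu (P x) (Q x)) m ∧
      tilde lam mu P Q (c m) x = convI lam mu (P x) (Q x) (hatC lam mu (P x) (Q x)) m := by
  induction m using Nat.strong_induction_on with
  | _ m ih =>
    intro x hx
    cases m with
    | zero =>
      simp [tilde, evalAt, a_zero, b_zero, c_zero, convI, hatA, hatB, hatC, I]
    | succ m =>
      have hmem := hJ.mem_nhds hx
      have hA : tilde lam mu P Q (a m) x = _ := (ih m m.lt_succ_self x hx).1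
      have hB' : tilde lam mu P Q (totalDeriv (b m)) x = convI lam mu (P x) (Q x) _ m :=
        (hsol.hasDerivAt_tilde hJ (b m) hx).unique
          ((hsol.hasDerivAt_convI hx (hsol.hasDerivAt_hatB hx) m).congr_of_eventuallyEq
            (Filter.eventually_of_mem hmem fun y hy => (ih m m.lt_succ_self y hy).2.1))
      have hC' : tilde lam mu P Q (totalDeriv (c m)) x = convI lam mu (P x) (Q x) _ m :=
        (hsol.hasDerivAt_tilde hJ (c m) hx).unique
          ((hsol.hasDerivAt_convI hx (hsol.hasDerivAt_hatC hx) m).congr_of_eventuallyEq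
            (Filter.eventually_of_mem hmem fun y hy => (ih m m.lt_succ_self y hy).2.2))
      have hB : tilde lam mu P Q (b (m + 1)) x
          = convI lam mu (P x) (Q x) (hatB lam mu (P x) (Q x)) (m + 1) := by
        rw [tilde_b_succ, hA, hB', convI, convI, convI, Finset.Nat.sum_antidiagonal_succ',
          Finset.mul_sum, Finset.mul_sum, ← Finset.sum_sub_distrib, hatB, mul_zero, zero_add]
        exact Finset.sum_congr rfl fun p _ => by ring
      have hC : tilde lam mu P Q (c (m + 1)) x
          = convI lam mu (P x) (Q x) (hatC lam mu (P x) (Q x)) (m + 1) := by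
        rw [tilde_c_succ, hA, hC', convI, convI, convI, Finset.Nat.sum_antidiagonal_succ',
          Finset.mul_sum, Finset.mul_sum, ← Finset.sum_sub_distrib, hatC, mul_zero, zero_add]
        exact Finset.sum_congr rfl fun p _ => by ring
      refine ⟨?_, hB, hC⟩
      have hsub := sum_antidiagonal_mul_self_sub (n := m)
        (x := fun k => tilde lam mu P Q (a k) x)
        (y := fun k => convI lam mu (P x) (Q x) (hatA lam mu (P x) (Q x)) k)
        fun k hk => (ih k (Nat.lt_succ_of_le hk) x hx).1
      have hbc : ∑ p ∈ Finset.HasAntidiagonal.antidiagonal (m + 1),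
            tilde lam mu P Q (b p.1) x * tilde lam mu P Q (c p.2) x
          = ∑ p ∈ Finset.HasAntidiagonal.antidiagonal (m + 1),
            convI lam mu (P x) (Q x) (hatB lam mu (P x) (Q x)) p.1
              * convI lam mu (P x) (Q x) (hatC lam mu (P x) (Q x)) p.2 := by
        refine Finset.sum_congr rfl fun p hp => ?_
        rw [Finset.HasAntidiagonal.mem_antidiagonal] at hp
        congr 1
        · rcases (show p.1 ≤ m + 1 by omega).lt_or_eq with h | h
          · exact (ih _ h x hx).2.1
          · rw [h, hB]
        · rcases (show p.2 ≤ m + 1 by omega).lt_or_eq with h | h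
          · exact (ih _ h x hx).2.2
          · rw [h, hC]
      have h1 := sum_antidiagonal_tilde (lam := lam) (mu := mu) (P := P) (Q := Q) m x
      have h2 := sum_antidiagonal_convI (lam := lam) (mu := mu) (P x) (Q x) m
      have h0 : tilde lam mu P Q (a 0) x = -1 := by simp [tilde, evalAt, a_zero]
      rw [h0] at hsub
      linarith

end Comparison

end

end AKNS

theorem theorem4p1 {N : ℕ} (lam mu : Fin N → ℝ) (J : Set ℝ) (hJ : IsOpen J)
    (P Q : ℝ → Fin 3 → Fin N → ℝ) (hsol : AKNS.IsSpatialSolution lam mu J P Q) :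
    ∀ m : ℕ, ∀ x ∈ J,
      AKNS.tilde lam mu P Q (AKNS.a (m + 1)) x =
          ∑ i ∈ Finset.range (m + 1),
            AKNS.I lam mu (P x) (Q x) i * AKNS.pairA lam mu (m - i) (P x) (Q x)
          - AKNS.I lam mu (P x) (Q x) (m + 1) ∧
      AKNS.tilde lam mu P Q (AKNS.b (m + 1)) x =
          √2 * ∑ i ∈ Finset.range (m + 1),
            AKNS.I lam mu (P x) (Q x) i * AKNS.pairB lam mu (m - i) (P x) (Q x) ∧
      AKNS.tilde lam mu P Q (AKNS.c (m + 1)) x =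
          √2 * ∑ i ∈ Finset.range (m + 1),
            AKNS.I lam mu (P x) (Q x) i * AKNS.pairC lam mu (m - i) (P x) (Q x) := by
  intro m x hx
  obtain ⟨hA, hB, hC⟩ := hsol.tilde_eq_convI hJ (m + 1) x hx
  rw [hA, hB, hC, AKNS.convI_succ, AKNS.convI_succ, AKNS.convI_succ]
  simp only [AKNS.hatA, AKNS.hatB, AKNS.hatC, Finset.mul_sum]
  refine ⟨by ring, ?_, ?_⟩
  · rw [mul_zero, zero_add]
    exact Finset.sum_congr rfl fun i _ => mul_left_comm _ _ _
  · rw [mul_zero, zero_add]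
    exact Finset.sum_congr rfl fun i _ => mul_left_comm _ _ _
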